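/- Let $X$ be a nonempty, convex and compact set in a Hausdorff locally convex (real topological vector) space $E$, and let $P : X \times X \to 2^X$ be a correspondence, that is, a map assigning to each pair $(x,y) \in X \times X$ a (possibly empty) subset $P(x,y)$ of $X$. Assume that: a) the set $\{y \in X : P(x,y) = \emptyset\}$ is nonempty and convex for each $x \in X$; b) the set $\{x \in X : P(x,y) = \emptyset\}$ is open in $X$ for each $y \in X$. Then there exists $x^* \in X$ such that $P(x^*,x^*) = \emptyset$. -/

import Mathlib

open Equiv Finset

/-! The multimap sending `x` to the set of `y` with `P (x, y) = ∅` has nonempty convex values and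
open fibres, so Browder's theorem gives a fixed point. A finite partition of unity reduces Browder
to Brouwer on a cube, and Brouwer is the limit of `exists_cell_sign_change` on finer grids. That
rests on `finsum_simplexDet_sub`: facet determinants of neighbouring simplices cancel, so a finite
change of labels keeps the total oriented volume, which is nonzero for a model labelling. -/

/-! ### Oriented volumes on the Freudenthal triangulation -/

/-- The `j`-th vertex of the simplex of the Freudenthal triangulation with base point `z` in which
the coordinate `i` is raised at step `β i`. -/
def freudenthalVertex {n : ℕ} (z : Fin n → ℤ) (β : Perm (Fin n)) (j : Fin (n + 1)) : Fin n → ℤ :=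
  fun i => z i + if (β i).val < j.val then 1 else 0

/-- The determinant of the values of `u` on the facet opposite to the `m`-th vertex. -/
def facetDet {n : ℕ} (u : (Fin n → ℤ) → Fin n → ℤ) (m : Fin (n + 1)) (β : Perm (Fin n))
    (z : Fin n → ℤ) : ℤ :=
  Matrix.det (Matrix.of fun j : Fin n => u (freudenthalVertex z β (m.succAbove j)))

/-- The oriented volume of the image of a Freudenthal simplex under `u`, times `n!`. -/
def simplexDet {n : ℕ} (u : (Fin n → ℤ) → Fin n → ℤ) (β : Perm (Fin n)) (z : Fin n → ℤ) : ℤ :=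
  Matrix.det (Matrix.of fun j : Fin (n + 1) =>
    (Fin.cons 1 (u (freudenthalVertex z β j)) : Fin (n + 1) → ℤ))

theorem simplexDet_eq_sum {n : ℕ} (u : (Fin n → ℤ) → Fin n → ℤ) (β : Perm (Fin n))
    (z : Fin n → ℤ) : simplexDet u β z = ∑ m : Fin (n + 1), (-1) ^ (m : ℕ) * facetDet u m β z := by
  rw [simplexDet, Matrix.det_succ_column_zero]
  refine Finset.sum_congr rfl fun m _ => ?_
  simp only [Matrix.of_apply, Fin.cons_zero, mul_one]
  rfl

/-- Otherwise column `i.succ` would be `c` times the column of ones. -/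
theorem exists_ne_of_simplexDet_ne_zero {n : ℕ} {u : (Fin n → ℤ) → Fin n → ℤ} {β : Perm (Fin n)}
    {z : Fin n → ℤ} (h : simplexDet u β z ≠ 0) (i : Fin n) (c : ℤ) :
    ∃ j, u (freudenthalVertex z β j) i ≠ c := by
  by_contra! hc
  refine h (Matrix.exists_mulVec_eq_zero_iff.1
    ⟨Pi.single i.succ 1 - Pi.single 0 c, fun h0 => ?_, ?_⟩)
  · have := congrFun h0 i.succ
    simp at this
  · ext j
    simp [Matrix.mulVec_sub, Matrix.mulVec_single, hc]

/-- Two simplices with the same base and consecutive steps exchanged differ in one vertex only;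
their orientations are opposite. -/
theorem facetDet_swap {n : ℕ} (u : (Fin (n + 1) → ℤ) → Fin (n + 1) → ℤ) (k : Fin n)
    (β : Perm (Fin (n + 1))) (z : Fin (n + 1) → ℤ) :
    facetDet u k.castSucc.succ (swap k.castSucc k.succ * β) z =
      facetDet u k.castSucc.succ β z := by
  unfold facetDet
  congr 2
  ext1 j
  congr 1
  ext i
  have hne := Fin.succAbove_ne k.castSucc.succ j
  generalize k.castSucc.succ.succAbove j = m at hne
  have hne' : m.val ≠ k.val + 1 := fun h => hne (Fin.ext (by simpa using h))
  have hiff : (swap k.castSucc k.succ (β i)).val < m.val ↔ (β i).val < m.val := by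
    rcases eq_or_ne (β i) k.castSucc with h | h
    · rw [h, swap_apply_left]
      simp only [Fin.val_succ, Fin.val_castSucc]
      omega
    rcases eq_or_ne (β i) k.succ with h' | h'
    · rw [h', swap_apply_right]
      simp only [Fin.val_succ, Fin.val_castSucc]
      omega
    · rw [swap_apply_of_ne_of_ne h h']
  simp only [freudenthalVertex, Perm.mul_apply, hiff]

/-- Without vertex 0, the coordinate raised first is raised on the whole facet, so it can be moved
into the base point. -/
theorem facetDet_rotate {n : ℕ} (u : (Fin (n + 1) → ℤ) → Fin (n + 1) → ℤ)
    (β : Perm (Fin (n + 1))) (z : Fin (n + 1) → ℤ) :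
    facetDet u 0 (finRotate (n + 1) * β) z =
      facetDet u (Fin.last _) β
        (z + fun i => if β i = Fin.last n then 1 else 0) := by
  unfold facetDet
  congr 2
  ext1 j
  congr 1
  ext i
  simp only [freudenthalVertex, Perm.mul_apply, Fin.succAbove_zero, Fin.succAbove_last,
    Fin.val_succ, Fin.val_castSucc, Pi.add_apply]
  rcases eq_or_ne (β i) (Fin.last n) with h | h
  · have := j.is_lt
    have h2 : ¬ n < j.val := by omega
    simp [h, h2]
  · have : (finRotate (n + 1) (β i)).val = (β i).val + 1 := coe_finRotate_of_ne_last h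
    simp only [this, h, if_false, add_zero, Nat.add_lt_add_iff_right]

/-- Discrete Stokes theorem: the total oriented volume does not depend on finitely many values. -/
theorem finsum_simplexDet_sub {n : ℕ} (u v : (Fin (n + 1) → ℤ) → Fin (n + 1) → ℤ)
    (huv : {x | u x ≠ v x}.Finite) :
    ∑ᶠ z, ∑ β : Perm (Fin (n + 1)),
      ((Perm.sign β : ℤˣ) : ℤ) * (simplexDet u β z - simplexDet v β z) = 0 := by
  set D : Fin (n + 2) → Perm (Fin (n + 1)) → (Fin (n + 1) → ℤ) → ℤ :=
    fun m β z => facetDet u m β z - facetDet v m β z with hD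
  have hfin : ∀ m β, (Function.support (D m β)).Finite := by
    intro m β
    have hinj : ∀ j, Function.Injective fun z => freudenthalVertex z β j := by
      intro j z z' h
      ext i
      simpa [freudenthalVertex] using congrFun h i
    refine (Set.finite_iUnion fun j : Fin (n + 2) =>
      huv.preimage (hinj j).injOn).subset fun z hz => ?_
    by_contra hcon
    simp only [Set.mem_iUnion, Set.mem_preimage, Set.mem_ofPred_eq, not_exists, not_not] at hcon
    exact hz (by simp [hD, facetDet, hcon])
  have hrw : ∀ z, ∑ β : Perm (Fin (n + 1)),
      ((Perm.sign β : ℤˣ) : ℤ) * (simplexDet u β z - simplexDet v β z) =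
      ∑ β : Perm (Fin (n + 1)), ∑ m : Fin (n + 2),
        (((Perm.sign β : ℤˣ) : ℤ) * (-1) ^ (m : ℕ)) * D m β z := by
    intro z
    refine sum_congr rfl fun β _ => ?_
    rw [simplexDet_eq_sum, simplexDet_eq_sum, ← sum_sub_distrib, mul_sum]
    exact sum_congr rfl fun m _ => by simp only [hD]; ring
  have hfin' : ∀ (c : ℤ) m β, (Function.support fun z => c * D m β z).Finite := fun c m β =>
    (hfin m β).subset (Function.support_mul_subset_right _ _)
  simp_rw [hrw]
  rw [finsum_sum_comm _ _ fun β _ => (Set.finite_iUnion fun m : Fin (n + 2) =>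
    hfin' (((Perm.sign β : ℤˣ) : ℤ) * (-1) ^ (m : ℕ)) m β).subset
    ((Finset.support_sum _ _).trans (Set.iUnion_mono fun m => Set.iUnion_subset fun _ => le_rfl))]
  have h1 : ∀ β : Perm (Fin (n + 1)), ∑ᶠ z, ∑ m : Fin (n + 2),
        (((Perm.sign β : ℤˣ) : ℤ) * (-1) ^ (m : ℕ)) * D m β z =
      ∑ m : Fin (n + 2), (((Perm.sign β : ℤˣ) : ℤ) * (-1) ^ (m : ℕ)) * ∑ᶠ z, D m β z := by
    intro β
    rw [finsum_sum_comm _ _ fun m _ => hfin' _ m β]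
    exact sum_congr rfl fun m _ => (mul_finsum (D m β) _).symm
  simp_rw [h1]
  rw [sum_comm, Fin.sum_univ_succ, Fin.sum_univ_castSucc]
  have hmid : ∀ k : Fin n, ∑ β : Perm (Fin (n + 1)), (((Perm.sign β : ℤˣ) : ℤ) *
      (-1) ^ (k.castSucc.succ : ℕ)) * ∑ᶠ z, D k.castSucc.succ β z = 0 := by
    intro k
    have := Equiv.sum_comp (Equiv.mulLeft (swap k.castSucc k.succ)) fun β =>
      (((Perm.sign β : ℤˣ) : ℤ) * (-1) ^ (k.castSucc.succ : ℕ)) * ∑ᶠ z, D k.castSucc.succ β z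
    simp only [Equiv.coe_mulLeft, Perm.sign_mul, Perm.sign_swap (Fin.castSucc_lt_succ (i := k)).ne,
      hD, facetDet_swap] at this
    simp only [Units.val_neg, neg_mul, one_mul, sum_neg_distrib] at this
    simp only [hD]
    linarith
  have hrot : ∀ β, ∑ᶠ z, D 0 (finRotate (n + 1) * β) z = ∑ᶠ z, D (Fin.last _) β z := by
    intro β
    rw [← finsum_comp_equiv (f := D (Fin.last _) β)
      (Equiv.addRight fun i => if β i = Fin.last n then (1 : ℤ) else 0)]
    simp only [hD, facetDet_rotate, Equiv.coe_addRight]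
  -- The sign `(-1) ^ n` of the rotation opposes the sign `(-1) ^ (n + 1)` of the last facet.
  rw [sum_congr rfl fun k _ => hmid k, ← Equiv.sum_comp (Equiv.mulLeft (finRotate (n + 1)))]
  simp only [Equiv.coe_mulLeft, hrot, Perm.sign_mul, sign_finRotate, sum_const_zero, zero_add,
    ← sum_add_distrib, Fin.succ_last]
  refine sum_eq_zero fun β _ => ?_
  simp only [Units.val_mul, Units.val_pow_eq_pow_val, Units.val_neg, Units.val_one, Fin.val_zero,
    Fin.val_last, pow_succ, pow_zero, Nat.add_sub_cancel]
  ring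

/-- The matrix is unitriangular up to permuting its columns by `β`, with column 0 fixed. -/
theorem simplexDet_pos_zero {n : ℕ} (β : Perm (Fin n)) :
    simplexDet (fun x i => if 0 < x i then 1 else 0) β 0 = ((Perm.sign β : ℤˣ) : ℤ) := by
  set M : Matrix (Fin (n + 1)) (Fin (n + 1)) ℤ := Matrix.of fun j c => if c ≤ j then 1 else 0
    with hM
  have hdet : M.det = 1 := by
    rw [Matrix.det_of_isLowerTriangular M fun i j hij => ?_]
    · simp [hM]
    · have : i < j := hij
      simp [hM, this]
  have hsub : (Matrix.of fun j : Fin (n + 1) => (Fin.cons 1 (fun i : Fin n =>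
      if 0 < freudenthalVertex 0 β j i then 1 else 0) : Fin (n + 1) → ℤ)) =
      M.submatrix id (Perm.decomposeFin.symm (0, β)) := by
    ext j c
    refine Fin.cases ?_ (fun i => ?_) c
    · simp [hM]
    · by_cases h : (β i).val < j.val
      · have : (β i).succ ≤ j := h
        simp [hM, freudenthalVertex, h, this]
      · have : ¬ (β i).succ ≤ j := h
        simp [hM, freudenthalVertex, h, this]
  rw [simplexDet, hsub, Matrix.det_permute', hdet]
  simp

/-- Discrete Poincaré–Miranda theorem. -/
theorem exists_cell_sign_change {n : ℕ} (k : ℤ) (u : (Fin (n + 1) → ℤ) → Fin (n + 1) → Prop)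
    (h0 : ∀ x i, x i = 0 → ¬ u x i) (hk : ∀ x i, x i = k → u x i) (hk0 : 0 < k) :
    ∃ z : Fin (n + 1) → ℤ, (∀ i, 0 ≤ z i ∧ z i < k) ∧ ∀ i,
      (∃ x, (∀ l, x l = z l ∨ x l = z l + 1) ∧ u x i) ∧
      (∃ x, (∀ l, x l = z l ∨ x l = z l + 1) ∧ ¬ u x i) := by
  classical
  -- For `v` only the cell at 0 contributes, with total `(n + 1)!`; `w` equals `v` off the box.
  let v : (Fin (n + 1) → ℤ) → Fin (n + 1) → ℤ := fun x i => if 0 < x i then 1 else 0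
  let w : (Fin (n + 1) → ℤ) → Fin (n + 1) → ℤ := fun x i =>
    if x ∈ Set.Icc 0 (fun _ => k) then if u x i then 1 else 0 else v x i
  have hv : ∀ z β, z ≠ 0 → simplexDet v β z = 0 := by
    intro z β hz
    by_contra h
    refine hz (funext fun i => ?_)
    obtain ⟨j, hj⟩ := exists_ne_of_simplexDet_ne_zero h i 0
    obtain ⟨j', hj'⟩ := exists_ne_of_simplexDet_ne_zero h i 1
    simp only [v, freudenthalVertex] at hj hj'
    simp only [Pi.zero_apply]
    split_ifs at hj hj' <;> omega
  have hw : ∃ z β, simplexDet w β z ≠ 0 := by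
    by_contra! hcon
    have hS := finsum_simplexDet_sub v w ((Set.finite_Icc (0 : Fin (n + 1) → ℤ)
      fun _ => k).subset fun x hx => by
        by_contra hx'
        exact hx (funext fun i => by simp only [w, if_neg hx']))
    simp only [hcon, sub_zero] at hS
    rw [finsum_eq_single _ 0 fun z hz => by simp [hv z _ hz]] at hS
    simp only [v, simplexDet_pos_zero] at hS
    simp [← Units.val_mul, Finset.card_univ, Fintype.card_perm, Nat.factorial_ne_zero] at hS
  obtain ⟨z, β, hzβ⟩ := hw
  have hvert : ∀ j i, freudenthalVertex z β j i = z i ∨ freudenthalVertex z β j i = z i + 1 := by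
    intro j i
    simp only [freudenthalVertex]
    split_ifs <;> simp
  have hw01 : ∀ x i, w x i = 0 ∨ w x i = 1 := by
    intro x i
    simp only [w, v]
    split_ifs <;> simp
  have hz : ∀ i, 0 ≤ z i ∧ z i < k := by
    intro i
    constructor
    · by_contra! h
      obtain ⟨j, hj⟩ := exists_ne_of_simplexDet_ne_zero hzβ i 0
      have hx := hvert j i
      generalize freudenthalVertex z β j = x at hj hx
      refine hj ?_
      simp only [w, v]
      split_ifs with h1 h2 h3
      · have := h1.1 i
        simp only [Pi.zero_apply] at this
        exact absurd h2 (h0 x i (by omega))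
      · rfl
      · omega
      · rfl
    · by_contra! h
      obtain ⟨j, hj⟩ := exists_ne_of_simplexDet_ne_zero hzβ i 1
      have hx := hvert j i
      generalize freudenthalVertex z β j = x at hj hx
      refine hj ?_
      simp only [w, v]
      split_ifs with h1 h2 h3
      · rfl
      · have := h1.2 i
        exact absurd (hk x i (by simp only at this; omega)) h2
      · rfl
      · omega
  have hbox : ∀ j, freudenthalVertex z β j ∈ Set.Icc 0 (fun _ => k) := fun j =>
    ⟨fun i => by have := hvert j i; have := hz i; simp only [Pi.zero_apply]; omega,
      fun i => by have := hvert j i; have := hz i; simp only; omega⟩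
  refine ⟨z, hz, fun i => ⟨?_, ?_⟩⟩
  · obtain ⟨j, hj⟩ := exists_ne_of_simplexDet_ne_zero hzβ i 0
    refine ⟨_, hvert j, ?_⟩
    by_contra h
    exact hj (by simp only [w, if_pos (hbox j), if_neg h])
  · obtain ⟨j, hj⟩ := exists_ne_of_simplexDet_ne_zero hzβ i 1
    refine ⟨_, hvert j, fun h => ?_⟩
    exact hj (by simp only [w, if_pos (hbox j), if_pos h])

/-! ### Brouwer's theorem -/

open Filter Topology in
/-- Brouwer's fixed point theorem for the cube. -/
theorem exists_fixedPoint_of_mem_Icc {n : ℕ} (g : (Fin (n + 1) → ℝ) → Fin (n + 1) → ℝ)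
    (hg : Continuous g) (h01 : ∀ x, g x ∈ Set.Icc 0 1) : ∃ x, g x = x := by
  have key : ∀ k : ℕ, ∃ p ∈ Set.Icc (0 : Fin (n + 1) → ℝ) 1, ∀ i,
      (∃ x, dist x p ≤ 1 / ((k : ℝ) + 1) ∧ g x i ≤ x i) ∧
      (∃ x, dist x p ≤ 1 / ((k : ℝ) + 1) ∧ x i ≤ g x i) := by
    intro k
    have hk : (0 : ℝ) < k + 1 := by positivity
    let s : (Fin (n + 1) → ℤ) → Fin (n + 1) → ℝ := fun x i => x i / ((k : ℝ) + 1)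
    -- The conjunct `0 < x i` forces the label on the face `x i = 0`, where `g` may vanish too.
    obtain ⟨z, hz, hzc⟩ := exists_cell_sign_change (k + 1 : ℤ)
      (fun x i => 0 < x i ∧ g (s x) i ≤ s x i) (fun x i h => by simp [h])
      (fun x i h => ⟨by omega, by
        have : s x i = 1 := by simp only [s, h]; push_cast; exact div_self hk.ne'
        rw [this]
        exact (h01 _).2 i⟩) (by positivity)
    have hdist : ∀ x, (∀ l, x l = z l ∨ x l = z l + 1) → dist (s x) (s z) ≤ 1 / ((k : ℝ) + 1) := by
      intro x hx
      refine (dist_pi_le_iff (by positivity)).2 fun l => ?_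
      simp only [s, Real.dist_eq, ← sub_div, abs_div, abs_of_pos hk]
      gcongr
      rcases hx l with h | h <;> simp [h]
    refine ⟨s z, ⟨fun i => ?_, fun i => ?_⟩, fun i => ?_⟩
    · have : (0 : ℝ) ≤ z i := by exact_mod_cast (hz i).1
      simp only [s, Pi.zero_apply]
      positivity
    · have : (z i : ℝ) ≤ k + 1 := by exact_mod_cast (hz i).2.le
      simp only [s, Pi.one_apply]
      exact (div_le_one hk).2 this
    · obtain ⟨⟨x, hx, hux⟩, ⟨y, hy, huy⟩⟩ := hzc i
      refine ⟨⟨s x, hdist x hx, hux.2⟩, ⟨s y, hdist y hy, ?_⟩⟩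
      by_cases h : 0 < y i
      · exact (not_le.1 fun h' => huy ⟨h, h'⟩).le
      · have h2 : y i = 0 := by have := hy i; have := hz i; omega
        have : s y i = 0 := by simp [s, h2]
        rw [this]
        exact (h01 _).1 i
  choose p hp hx using key
  obtain ⟨q, -, φ, hφ, hq⟩ := isCompact_Icc.tendsto_subseq hp
  have hlim : ∀ x : ℕ → Fin (n + 1) → ℝ, (∀ k, dist (x k) (p k) ≤ 1 / ((k : ℝ) + 1)) →
      Tendsto (x ∘ φ) atTop (𝓝 q) := by
    intro x hxp
    refine tendsto_of_tendsto_of_dist hq (squeeze_zero (fun _ => dist_nonneg) (fun k => ?_)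
      (tendsto_one_div_add_atTop_nhds_zero_nat.comp hφ.tendsto_atTop))
    rw [dist_comm]
    exact hxp _
  refine ⟨q, funext fun i => le_antisymm ?_ ?_⟩
  · choose x hxp hxg using fun k => (hx k i).1
    have h := hlim x hxp
    exact le_of_tendsto_of_tendsto' (((continuous_apply i).comp hg).continuousAt.tendsto.comp h)
      ((continuous_apply i).continuousAt.tendsto.comp h) fun k => hxg _
  · choose x hxp hxg using fun k => (hx k i).2
    have h := hlim x hxp
    exact le_of_tendsto_of_tendsto' ((continuous_apply i).continuousAt.tendsto.comp h)
      (((continuous_apply i).comp hg).continuousAt.tendsto.comp h) fun k => hxg _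

/-- A continuous retraction of `ℝⁿ` onto the standard simplex. -/
theorem exists_retraction_stdSimplex (n : ℕ) : ∃ r : (Fin (n + 1) → ℝ) → Fin (n + 1) → ℝ,
    Continuous r ∧ (∀ s, r s ∈ stdSimplex ℝ (Fin (n + 1))) ∧
      ∀ s ∈ stdSimplex ℝ (Fin (n + 1)), r s = s := by
  let S : (Fin (n + 1) → ℝ) → ℝ := fun s => ∑ i, max (s i) 0
  have hS : Continuous S := by fun_prop
  have hm : ∀ s, 0 < max 1 (S s) := fun s => lt_max_of_lt_left one_pos
  -- The numerators add up to `max 1 (S s)`.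
  refine ⟨fun s i => (max (s i) 0 + max (1 - S s) 0 / (n + 1)) / max 1 (S s), ?_, fun s => ⟨?_, ?_⟩,
    fun s hs => ?_⟩
  · exact continuous_pi fun i => Continuous.div (by fun_prop) (by fun_prop) fun s => (hm s).ne'
  · intro i
    have := hm s
    positivity
  · have hn : (n + 1 : ℝ) ≠ 0 := by positivity
    rw [← sum_div, div_eq_one_iff_eq (hm s).ne', sum_add_distrib]
    simp only [sum_const, card_univ, Fintype.card_fin, nsmul_eq_mul, Nat.cast_add, Nat.cast_one]
    rw [mul_div_cancel₀ _ hn]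
    change S s + _ = _
    rcases le_total (S s) 1 with h | h
    · rw [max_eq_left (by linarith), max_eq_left h]; ring
    · rw [max_eq_right (by linarith), max_eq_right h]; ring
  · have h1 : S s = 1 := by
      rw [← hs.2]
      exact sum_congr rfl fun i _ => max_eq_left (hs.1 i)
    ext i
    simp [h1, hs.1 i]

/-! ### Browder's theorem and the conclusion -/

/-- The Browder fixed point theorem for relations with convex values and open fibres. -/
theorem exists_mem_of_convex_of_isOpen_fiber {E : Type*} [AddCommGroup E] [Module ℝ E]
    [TopologicalSpace E] [IsTopologicalAddGroup E] [ContinuousSMul ℝ E] [T2Space E]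
    {X : Set E} (hXne : X.Nonempty) (hXconv : Convex ℝ X) (hXcomp : IsCompact X)
    (F : X → Set X) (hne : ∀ x, (F x).Nonempty)
    (hconv : ∀ x, Convex ℝ ((fun y : X => (y : E)) '' F x))
    (hopen : ∀ y, IsOpen {x | y ∈ F x}) : ∃ x, x ∈ F x := by
  have : CompactSpace X := isCompact_iff_compactSpace.1 hXcomp
  have : Nonempty X := hXne.to_subtype
  obtain ⟨t, ht⟩ := isCompact_univ.elim_finite_subcover (fun y : X => {x | y ∈ F x}) hopen
    fun x _ => Set.mem_iUnion.2 (hne x)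
  obtain ⟨n, e, het⟩ : ∃ (n : ℕ) (e : Fin (n + 1) → X), ∀ y ∈ t, ∃ i, e i = y := by
    obtain ⟨m, hm⟩ : ∃ m, t.card = m + 1 := by
      refine Nat.exists_eq_succ_of_ne_zero fun h => ?_
      rw [Finset.card_eq_zero.1 h] at ht
      simpa using ht (Set.mem_univ (Classical.arbitrary X))
    exact ⟨m, fun i => (t.equivFinOfCardEq hm).symm i, fun y hy =>
      ⟨t.equivFinOfCardEq hm ⟨y, hy⟩, by simp⟩⟩
  obtain ⟨ρ, hρ⟩ := PartitionOfUnity.exists_isSubordinate isClosed_univ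
    (fun i => {x | e i ∈ F x}) (fun i => hopen (e i)) fun x hx => by
      obtain ⟨y, hy, hxy⟩ := Set.mem_iUnion₂.1 (ht hx)
      obtain ⟨i, rfl⟩ := het y hy
      exact Set.mem_iUnion.2 ⟨i, hxy⟩
  have hsum : ∀ x, ∑ i, ρ i x = 1 := fun x => by
    rw [← finsum_eq_sum_of_fintype]
    exact ρ.sum_eq_one (Set.mem_univ x)
  obtain ⟨r, hrc, hrs, hrid⟩ := exists_retraction_stdSimplex n
  let c : (Fin (n + 1) → ℝ) → X := fun s => ⟨∑ i, r s i • (e i : E),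
    hXconv.sum_mem (fun i _ => (hrs s).1 i) (hrs s).2 fun i _ => (e i).2⟩
  have hc : Continuous c := by
    refine Continuous.subtype_mk (continuous_finsetSum _ fun i _ => ?_) _
    exact ((continuous_apply i).comp hrc).smul continuous_const
  obtain ⟨s, hs⟩ := exists_fixedPoint_of_mem_Icc (fun s i => ρ i (c s))
    (continuous_pi fun i => (ρ i).continuous.comp hc)
    fun s => ⟨fun i => ρ.nonneg i _, fun i => ρ.le_one i _⟩
  have hsi : ∀ i, ρ i (c s) = s i := congrFun hs
  have hsS : s ∈ stdSimplex ℝ (Fin (n + 1)) :=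
    ⟨fun i => hsi i ▸ ρ.nonneg i _, by simpa only [hsi] using hsum (c s)⟩
  refine ⟨c s, ?_⟩
  have hmem : (c s : E) ∈ (fun y : X => (y : E)) '' F (c s) := by
    -- Only indices with `ρ i (c s) ≠ 0` remain, and for these `e i ∈ F (c s)`.
    have hcs : (c s : E) = ∑ i with s i ≠ 0, s i • (e i : E) := by
      simp only [c, hrid s hsS]
      rw [Finset.sum_filter]
      exact sum_congr rfl fun i _ => by by_cases h : s i = 0 <;> simp [h]
    rw [hcs]
    refine (hconv _).sum_mem (fun i _ => hsS.1 i) (by rw [Finset.sum_filter_ne_zero]; exact hsS.2)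
      fun i hi => ⟨e i, ?_, rfl⟩
    exact hρ i (subset_closure (by
      simpa only [Function.mem_support, hsi] using (Finset.mem_filter.1 hi).2))
  obtain ⟨y, hy, hyc⟩ := hmem
  have hyx : y = c s := Subtype.ext hyc
  rwa [hyx] at hy

theorem corollary1 {E : Type*} [AddCommGroup E] [Module ℝ E] [TopologicalSpace E]
    [IsTopologicalAddGroup E] [ContinuousSMul ℝ E] [T2Space E] [LocallyConvexSpace ℝ E]
    (X : Set E) (hXne : X.Nonempty) (hXconv : Convex ℝ X) (hXcomp : IsCompact X)
    (P : X × X → Set X)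
    (hne : ∀ x : X, {y : X | P (x, y) = ∅}.Nonempty)
    (hconv : ∀ x : X, Convex ℝ ((fun y : X => (y : E)) '' {y : X | P (x, y) = ∅}))
    (hopen : ∀ y : X, IsOpen {x : X | P (x, y) = ∅}) :
    ∃ xs : X, P (xs, xs) = ∅ :=
  exists_mem_of_convex_of_isOpen_fiber hXne hXconv hXcomp (fun x => {y | P (x, y) = ∅})
    hne hconv hopen
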